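/- Let $d\ge 2$ and $r\ge 2$ be integers. Let $\mathrm{SO}(d)$ be the group of special orthogonal real $d\times d$ matrices, acting on the Euclidean unit sphere $\mathbb S^{d-1}\subset\mathbb R^d$ by matrix-vector multiplication and on functions $f:\mathbb S^{d-1}\to\mathbb R$ by $(\gamma.f)(v):=f(\gamma^{-1}.v)$. Let $\mu$ be the spherical (surface) measure on $\mathbb S^{d-1}$. An $r$-tuple $(\gamma_1,\dots,\gamma_r)\in\mathrm{SO}(d)^r$ *fractionally divides* $\mathbb S^{d-1}$ if there is $f\in L^2(\mathbb S^{d-1},\mu)$ such that $\sum_{i=1}^r\gamma_i.f=1$ $\mu$-almost everywhere and $f\neq 1/r$ on a set of positive $\mu$-measure. For an integer $0\le \ell\le r$ and $\gamma'=(\gamma_{\ell+1},\dots,\gamma_r)\in\mathrm{SO}(d)^{r-\ell}$, let $$\mathcal D_{d,r}(\gamma'):=\{(\gamma_1,\dots,\gamma_\ell)\in\mathrm{SO}(d)^\ell : (\gamma_1,\dots,\gamma_r)\text{ fractionally divides }\mathbb S^{d-1}\}.$$ Let $f^{\mathrm{top}}(d,r)$ (respectively $f^{\mathrm{Haar}}(d,r)$)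 be the smallest integer $\ell\in\{0,\dots,r\}$ such that for every $\gamma'\in\mathrm{SO}(d)^{r-\ell}$ the set $\mathcal D_{d,r}(\gamma')$ is meager in $\mathrm{SO}(d)^\ell$ (respectively null for the Haar measure of $\mathrm{SO}(d)^\ell$). **Theorem.** For every $d\ge 2$ and $r\ge 2$, put $\ell:=\lfloor r/2\rfloor$ if $d\ge 3$ and $\ell:=1$ if $d=2$. Then $f^{\mathrm{top}}(d,r)$ and $f^{\mathrm{Haar}}(d,r)$ exist and $$f^{\mathrm{top}}(d,r)\le \ell\quad\text{and}\quad f^{\mathrm{Haar}}(d,r)\le \ell.$$ Moreover, for this $\ell$ and every $\gamma'\in\mathrm{SO}(d)^{r-\ell}$, the set $\mathcal D_{d,r}(\gamma')$ is both meager and Haar-null in $\mathrm{SO}(d)^\ell$. -/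

import Mathlib

open MeasureTheory

noncomputable section

namespace SphereDivision

/-- The Euclidean unit sphere `S^{d-1}` in `ℝ^d`. -/
abbrev Sphere (d : ℕ) : Type := Metric.sphere (0 : EuclideanSpace ℝ (Fin d)) 1

/-- The group `SO(d)` of special orthogonal real `d × d` matrices, with the topology
inherited from the space of all matrices. -/
abbrev SO (d : ℕ) : Type := Matrix.specialOrthogonalGroup (Fin d) ℝ

/-- `SO(d)` carries its Borel σ-algebra. -/
instance instMeasurableSpaceSO (d : ℕ) : MeasurableSpace (SO d) := borel (SO d)

instance instBorelSpaceSO (d : ℕ) : BorelSpace (SO d) := ⟨rfl⟩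

/-- `SO(d)` is second countable, so the Borel σ-algebra of `SO(d)^ℓ` is the product one. -/
instance instSecondCountableTopologySO (d : ℕ) : SecondCountableTopology (SO d) :=
  haveI : SecondCountableTopology (Matrix (Fin d) (Fin d) ℝ) :=
    inferInstanceAs (SecondCountableTopology (Fin d → Fin d → ℝ))
  TopologicalSpace.Subtype.secondCountableTopology
    ((Matrix.specialOrthogonalGroup (Fin d) ℝ : Submonoid _) : Set (Matrix (Fin d) (Fin d) ℝ))

/-- The group operations of `SO(d)` are continuous (inversion is transposition). -/
instance instIsTopologicalGroupSO (d : ℕ) : IsTopologicalGroup (SO d) where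
  continuous_mul := continuous_mul
  continuous_inv := by
    refine Continuous.subtype_mk ?_ _
    exact continuous_subtype_val.star

/-- `SO(d)` is compact: it is closed and has bounded entries. -/
instance instCompactSpaceSO (d : ℕ) : CompactSpace (SO d) := by
  refine (isCompact_iff_compactSpace (s := ((Matrix.specialOrthogonalGroup (Fin d) ℝ :
    Submonoid _) : Set (Matrix (Fin d) (Fin d) ℝ)))).1 ?_
  have hc : IsCompact (Set.univ.pi fun _ : Fin d => Set.univ.pi fun _ : Fin d =>
      Set.Icc (-1 : ℝ) 1) :=
    isCompact_univ_pi fun _ => isCompact_univ_pi fun _ => isCompact_Icc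
  refine IsCompact.of_isClosed_subset (s := {A : Matrix (Fin d) (Fin d) ℝ | A ∈ (Set.univ.pi
    fun _ : Fin d => Set.univ.pi fun _ : Fin d => Set.Icc (-1 : ℝ) 1)}) hc ?_ ?_
  · have : ((Matrix.specialOrthogonalGroup (Fin d) ℝ : Submonoid _) :
        Set (Matrix (Fin d) (Fin d) ℝ)) = {A | A * A.transpose = 1} ∩ {A | A.det = 1} := by
      ext A
      simp [Matrix.mem_specialOrthogonalGroup_iff, Matrix.mem_orthogonalGroup_iff]
    rw [this]
    refine IsClosed.inter (isClosed_eq ?_ continuous_const) (isClosed_eq ?_ continuous_const)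
    · exact continuous_id.mul continuous_id.matrix_transpose
    · exact continuous_id.matrix_det
  · intro A hA i _ j _
    have h := (Matrix.mem_specialOrthogonalGroup_iff.1 hA).1
    have h1 := entry_norm_bound_of_unitary (𝕜 := ℝ) h i j
    exact abs_le.1 h1

/-- The action `γ.x` of a rotation on a point of the sphere: the matrix-vector product. -/
def act {d : ℕ} (γ : SO d) (x : Sphere d) : Sphere d :=
  ⟨WithLp.toLp 2 (γ.1.mulVec x.1.ofLp), by
    have hx : ‖x.1‖ = 1 := by simp
    have hγ : γ.1.transpose * γ.1 = 1 := by
      exact (Matrix.mem_orthogonalGroup_iff' _ _).1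
        (Matrix.mem_specialOrthogonalGroup_iff.1 γ.2).1
    have key : ‖WithLp.toLp 2 (γ.1.mulVec x.1.ofLp)‖ ^ 2 = ‖x.1‖ ^ 2 := by
      rw [EuclideanSpace.real_norm_sq_eq, EuclideanSpace.real_norm_sq_eq]
      have : γ.1.mulVec x.1.ofLp ⬝ᵥ γ.1.mulVec x.1.ofLp = x.1.ofLp ⬝ᵥ x.1.ofLp := by
        rw [Matrix.dotProduct_mulVec, Matrix.vecMul_mulVec, hγ, Matrix.vecMul_one]
      simpa [dotProduct, sq] using this
    rw [mem_sphere_zero_iff_norm]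
    have h0 := norm_nonneg (WithLp.toLp 2 (γ.1.mulVec x.1.ofLp))
    rw [hx] at key
    nlinarith⟩

/-- The left action of `SO(d)` on functions on the sphere: `(γ.f)(v) = f(γ⁻¹.v)`. -/
def actFun {d : ℕ} (γ : SO d) (f : Sphere d → ℝ) : Sphere d → ℝ :=
  fun v => f (act γ⁻¹ v)

/-- The spherical (surface) measure on `S^{d-1}`, of total mass `2 π^{d/2} / Γ(d/2)`. -/
def sphereMeasure (d : ℕ) : Measure (Sphere d) :=
  (volume : Measure (EuclideanSpace ℝ (Fin d))).toSphere

/-- The `r`-tuple `γ` fractionally divides `S^{d-1}`: some `f ∈ L²(S^{d-1})` satisfies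
`∑ i, γ_i.f = 1` almost everywhere and differs from `1/r` on a set of positive measure. -/
def FractionallyDivides {d r : ℕ} (γ : Fin r → SO d) : Prop :=
  ∃ f : Sphere d → ℝ, MemLp f 2 (sphereMeasure d) ∧
    (∀ᵐ x ∂(sphereMeasure d), ∑ i, actFun (γ i) f x = 1) ∧
    0 < sphereMeasure d {x | f x ≠ 1 / (r : ℝ)}

/-- The section at `γ'` of the set of dividing tuples: all `(γ_1, …, γ_ℓ)` such that the
concatenation of `(γ_1, …, γ_ℓ)` and `γ'` fractionally divides `S^{d-1}`. -/
def dividingSection {d m : ℕ} (ℓ : ℕ) (γ' : Fin m → SO d) : Set (Fin ℓ → SO d) :=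
  {γ | FractionallyDivides (Fin.append γ γ')}

/-- `s ⊆ SO(d)^ℓ` is null for the Haar measure of the compact group `SO(d)^ℓ`. -/
def IsHaarNull {d ℓ : ℕ} (s : Set (Fin ℓ → SO d)) : Prop :=
  (Measure.haar : Measure (Fin ℓ → SO d)) s = 0

/-- The smallest `ℓ ∈ {0, …, r}` such that for all `γ' ∈ SO(d)^{r-ℓ}` the section at `γ'` is
meager in `SO(d)^ℓ` (it would be `⊤` if there were no such `ℓ`). -/
def fTop (d r : ℕ) : ℕ∞ :=
  sInf {n : ℕ∞ | ∃ ℓ : ℕ, n = ℓ ∧ ℓ ≤ r ∧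
    ∀ γ' : Fin (r - ℓ) → SO d, IsMeagre (dividingSection ℓ γ')}

/-- The smallest `ℓ ∈ {0, …, r}` such that for all `γ' ∈ SO(d)^{r-ℓ}` the section at `γ'` is
Haar-null in `SO(d)^ℓ` (it would be `⊤` if there were no such `ℓ`). -/
def fHaar (d r : ℕ) : ℕ∞ :=
  sInf {n : ℕ∞ | ∃ ℓ : ℕ, n = ℓ ∧ ℓ ≤ r ∧
    ∀ γ' : Fin (r - ℓ) → SO d, IsHaarNull (dividingSection ℓ γ')}

end SphereDivision

end

open SphereDivision

/-! If `f` witnesses a division, then `g = f - 1/r` is a nonzero `L²` function with `∑ γ_i.g = 0`.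
The degree `n` moments of `g` form a vector in the `n`-th tensor power of `ℝ^d`, on which a rotation
acts by `γ^{⊗n}`; hence `∑ γ_i^{⊗n}` kills that vector. If these operators are invertible for all
`n`, every moment vanishes and `g = 0` by Stone–Weierstrass. So `dividingSection` lies in the
countable union over `n` of the zero sets of `det (∑ γ_i^{⊗n})`
(`exists_det_eq_zero_of_fractionallyDivides`).

Each such determinant is polynomial in the matrix entries, hence analytic along translates of plane
rotations. As these generate `SO(d)^ℓ`, a Fubini argument (`OneParam.IsThin.measure_eq_zero`) shows
that its zero set is everything or Haar-null; being closed, a null zero set is also nowhere dense.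

It remains to find, for each `n`, one choice of free rotations with nonzero determinant. For `d ≥ 3`
let all of them equal one prescribed rotation: `ℓ + 1` copies of one isometry cannot be cancelled by
at most `ℓ` others (`exists_det_sum_kroneckerPow_ne_zero`). For `d = 2` all rotations diagonalize
simultaneously over `ℂ`, and each eigenvalue vanishes only for a null set of angles of the single
free rotation (`exists_det_sum_kroneckerPow_two_ne_zero`). -/

/-- The zero set of a real analytic function of one real variable is everything or null. -/
theorem analytic_zeroSet_univ_or_null {E : Type*} [NormedAddCommGroup E] [NormedSpace ℝ E]
    {f : ℝ → E} (hf : AnalyticOnNhd ℝ f Set.univ) :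
    (∀ t, f t = 0) ∨ volume {t | f t = 0} = 0 := by
  by_contra! h
  obtain ⟨⟨x, hx⟩, h2⟩ := h
  have h3 := ae_restrict_le_codiscreteWithin (μ := (volume : Measure ℝ)) MeasurableSet.univ
    (hf.preimage_zero_mem_codiscrete hx)
  rw [Measure.restrict_univ, mem_ae_iff] at h3
  apply h2
  convert h3 using 2
  ext t
  simp

/-! ### Null sets in a group generated by one-parameter curves -/

namespace OneParam

variable {G ι : Type*} [Group G] [TopologicalSpace G]

/-- A closed set which every translate of every curve `φ i` either stays in forever or meets
in a null set of times. -/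
def IsThin (φ : ι → ℝ → G) (Z : Set G) : Prop :=
  IsClosed Z ∧ ∀ i g h, (∀ t, h * φ i t * g ∈ Z) ∨ volume {t | h * φ i t * g ∈ Z} = 0

/-- The points whose whole `ψ`-orbit stays in `Z`. -/
def core (ψ : ℝ → G) (Z : Set G) : Set G := {g | ∀ t, ψ t * g ∈ Z}

/-- If some `ψ t` moves some point of a translated curve out of `Z`, thinness of `Z` along the curve
translated further by `ψ t` bounds the set of times. This is why thinness allows arbitrary left
factors. -/
theorem IsThin.core [IsTopologicalGroup G] {φ : ι → ℝ → G} {Z : Set G} (hZ : IsThin φ Z)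
    (ψ : ℝ → G) : IsThin φ (core ψ Z) := by
  constructor
  · have : OneParam.core ψ Z = ⋂ t, (fun g => ψ t * g) ⁻¹' Z := by ext; simp [OneParam.core]
    rw [this]
    exact isClosed_iInter fun t => hZ.1.preimage (continuous_const.mul continuous_id)
  · intro i g h
    by_cases H : ∀ t s, ψ t * (h * φ i s * g) ∈ Z
    · exact .inl fun s t => H t s
    · push Not at H
      obtain ⟨t, s, hts⟩ := H
      rcases hZ.2 i g (ψ t * h) with h1 | h1
      · exact absurd (by simpa [mul_assoc] using h1 s) hts
      · refine .inr (measure_mono_null (fun u hu => ?_) h1)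
        simpa [mul_assoc] using hu t

variable [IsTopologicalGroup G] [SecondCountableTopology G] [MeasurableSpace G] [BorelSpace G]

/-- Fubini on `[0,1] × G`: by left invariance every time slice of `{φ_t g ∈ Z}` has measure `μ Z`,
while the slice over `g` is null unless `g` lies in the core. Hence `μ Z ≤ μ (core)`. -/
theorem IsThin.measure_diff_core {φ : ι → ℝ → G} (hφ : ∀ i, Continuous (φ i))
    (h0 : ∀ i, φ i 0 = 1) {Z : Set G} (hZ : IsThin φ Z) (i : ι)
    (μ : Measure G) [IsFiniteMeasure μ] [μ.IsMulLeftInvariant] :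
    μ (Z \ OneParam.core (φ i) Z) = 0 := by
  have hsub : OneParam.core (φ i) Z ⊆ Z := fun g hg => by simpa [h0] using hg 0
  have hc := (hZ.core (φ i)).1
  rw [measure_sdiff hsub hc.measurableSet.nullMeasurableSet (measure_ne_top _ _),
    tsub_eq_zero_iff_le]
  let ν : Measure ℝ := volume.restrict (Set.Icc 0 1)
  let E : Set (ℝ × G) := {p | φ i p.1 * p.2 ∈ Z}
  have hE : MeasurableSet E :=
    (hZ.1.preimage (((hφ i).comp continuous_fst).mul continuous_snd)).measurableSet
  have h1 : (ν.prod μ) E = μ Z := by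
    rw [Measure.prod_apply hE]
    have : ∀ t, μ (Prod.mk t ⁻¹' E) = μ Z := fun t => measure_preimage_mul μ (φ i t) Z
    simp [this, ν]
  have h2 : (ν.prod μ) E ≤ μ (OneParam.core (φ i) Z) := by
    rw [Measure.prod_apply_symm hE, ← lintegral_indicator_one hc.measurableSet]
    refine lintegral_mono fun g => ?_
    by_cases hg : g ∈ OneParam.core (φ i) Z
    · rw [Set.indicator_of_mem hg]
      refine (measure_mono (Set.subset_univ _)).trans ?_
      simp [ν]
    · rw [Set.indicator_of_notMem hg]
      rcases hZ.2 i g 1 with h3 | h3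
      · exact absurd (fun t => by simpa using h3 t) hg
      · refine le_of_eq (measure_mono_null (t := _) subset_rfl
          (Measure.absolutelyContinuous_of_le Measure.restrict_le_self ?_))
        simpa [E] using h3
  exact h1 ▸ h2

/-- Iterated cores along a word of curves. -/
def wordCore (φ : ι → ℝ → G) (Z : Set G) : List ι → Set G
  | [] => Z
  | i :: w => core (φ i) (wordCore φ Z w)

/-- If the one-parameter subgroups `φ i` generate `G`, a thin proper subset is null. -/
theorem IsThin.measure_eq_zero [Countable ι] {φ : ι → ℝ → G} (hφ : ∀ i, Continuous (φ i))
    (h0 : ∀ i, φ i 0 = 1) (hinv : ∀ i t, (φ i t)⁻¹ = φ i (-t))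
    (hgen : Subgroup.closure {g | ∃ i t, φ i t = g} = ⊤)
    {Z : Set G} (hZ : IsThin φ Z) (hne : Z ≠ Set.univ)
    (μ : Measure G) [IsFiniteMeasure μ] [μ.IsMulLeftInvariant] : μ Z = 0 := by
  have hthin : ∀ w, IsThin φ (wordCore φ Z w) := by
    intro w
    induction w with
    | nil => exact hZ
    | cons i w ih => exact ih.core _
  have hnull : ∀ w, μ (Z \ wordCore φ Z w) = 0 := by
    intro w
    induction w with
    | nil => simp [wordCore]
    | cons i w ih =>
      refine measure_mono_null (fun g hg => ?_)
        (measure_union_null ih ((hthin w).measure_diff_core hφ h0 i μ))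
      by_cases h : g ∈ wordCore φ Z w
      · exact .inr ⟨h, hg.2⟩
      · exact .inl ⟨hg.1, h⟩
  -- The intersection over all words is stable under left multiplication by each `φ i t`, hence by
  -- `G`. Were it nonempty it would be all of `G`, and the empty word would give `Z = G`.
  have hempty : ⋂ w, wordCore φ Z w = ∅ := by
    by_contra hN
    obtain ⟨g, hg⟩ := Set.nonempty_iff_ne_empty.2 hN
    apply hne
    have key : ∀ h : G, h ∈ Subgroup.closure {g | ∃ i t, φ i t = g} →
        ∀ g ∈ ⋂ w, wordCore φ Z w, h * g ∈ ⋂ w, wordCore φ Z w := by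
      have hstep : ∀ i t, ∀ g ∈ ⋂ w, wordCore φ Z w, φ i t * g ∈ ⋂ w, wordCore φ Z w := by
        intro i t g hg
        rw [Set.mem_iInter] at hg ⊢
        exact fun w => hg (i :: w) t
      intro h hh
      induction hh using Subgroup.closure_induction'' with
      | mem x hx => obtain ⟨i, t, rfl⟩ := hx; exact hstep i t
      | inv_mem x hx => obtain ⟨i, t, rfl⟩ := hx; rw [hinv]; exact hstep i _
      | one => simp
      | mul x y _ _ hx hy => intro g hg; rw [mul_assoc]; exact hx _ (hy _ hg)
    refine Set.eq_univ_of_forall fun x => ?_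
    have := key (x * g⁻¹) (by rw [hgen]; trivial) g hg
    rw [inv_mul_cancel_right, Set.mem_iInter] at this
    exact this []
  have : Z = ⋃ w, Z \ wordCore φ Z w := by
    rw [← Set.sdiff_iInter, hempty, Set.sdiff_empty]
  rw [this]
  exact measure_iUnion_null hnull

end OneParam

/-! ### Plane rotations generate `SO(d)` -/

open Matrix in
/-- The rotation by the angle `t` in the coordinate plane `(i, j)`. -/
noncomputable def planeRotMatrix {d : ℕ} (i j : Fin d) (t : ℝ) : Matrix (Fin d) (Fin d) ℝ :=
  1 + (Real.cos t - 1) • (single i i 1 + single j j 1) + Real.sin t • (single i j 1 - single j i 1)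

section planeRot

open Matrix

variable {d : ℕ}

theorem planeRotMatrix_zero (i j : Fin d) : planeRotMatrix i j 0 = 1 := by
  simp [planeRotMatrix]

theorem planeRotMatrix_mul {i j : Fin d} (hij : i ≠ j) (s t : ℝ) :
    planeRotMatrix i j s * planeRotMatrix i j t = planeRotMatrix i j (s + t) := by
  have hji := hij.symm
  set P : Matrix (Fin d) (Fin d) ℝ := single i i 1 + single j j 1 with hP
  set J : Matrix (Fin d) (Fin d) ℝ := single i j 1 - single j i 1 with hJ
  have hPP : P * P = P := by simp [hP, mul_add, add_mul, hij, hji]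
  have hPJ : P * J = J := by simp [hP, hJ, mul_sub, add_mul, hij, hji]
  have hJP : J * P = J := by simp [hP, hJ, mul_add, sub_mul, hij, hji]; abel
  have hJJ : J * J = -P := by simp [hP, hJ, mul_sub, sub_mul, hij, hji]; abel
  simp only [planeRotMatrix, ← hP, ← hJ, Real.cos_add, Real.sin_add]
  simp only [mul_add, add_mul, smul_mul_assoc, mul_smul_comm, hPP, hPJ, hJP, hJJ, one_mul, mul_one]
  module

theorem planeRotMatrix_transpose (i j : Fin d) (t : ℝ) :
    (planeRotMatrix i j t)ᵀ = planeRotMatrix i j (-t) := by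
  simp only [planeRotMatrix, transpose_add, transpose_smul, transpose_sub, transpose_one,
    transpose_single, Real.cos_neg, Real.sin_neg]
  module

theorem planeRotMatrix_mem {i j : Fin d} (hij : i ≠ j) (t : ℝ) :
    planeRotMatrix i j t ∈ specialOrthogonalGroup (Fin d) ℝ := by
  have h : ∀ t, planeRotMatrix i j t * (planeRotMatrix i j t)ᵀ = 1 := fun t => by
    rw [planeRotMatrix_transpose, planeRotMatrix_mul hij, add_neg_cancel, planeRotMatrix_zero]
  refine mem_specialOrthogonalGroup_iff.2 ⟨(mem_orthogonalGroup_iff _ _).2 (h t), ?_⟩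
  -- The determinant is the square of that of the half-angle rotation, which orthogonality makes
  -- `1`.
  rw [← add_halves t, ← planeRotMatrix_mul hij, det_mul]
  have := congrArg det (h (t / 2))
  rwa [det_mul, det_transpose, det_one] at this

/-- The plane rotation as an element of `SO(d)`. -/
noncomputable def planeRot (p : {p : Fin d × Fin d // p.1 ≠ p.2}) (t : ℝ) : SO d :=
  ⟨planeRotMatrix p.1.1 p.1.2 t, planeRotMatrix_mem p.2 t⟩

theorem planeRot_zero (p : {p : Fin d × Fin d // p.1 ≠ p.2}) : planeRot p 0 = 1 :=
  Subtype.ext (planeRotMatrix_zero _ _)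

theorem planeRot_inv (p : {p : Fin d × Fin d // p.1 ≠ p.2}) (t : ℝ) :
    (planeRot p t)⁻¹ = planeRot p (-t) := by
  rw [inv_eq_iff_mul_eq_one]
  refine Subtype.ext ?_
  change planeRotMatrix _ _ t * planeRotMatrix _ _ (-t) = 1
  rw [planeRotMatrix_mul p.2, add_neg_cancel, planeRotMatrix_zero]

theorem analyticOnNhd_planeRotMatrix (i j a b : Fin d) :
    AnalyticOnNhd ℝ (fun t => planeRotMatrix i j t a b) Set.univ := by
  simp only [planeRotMatrix, Matrix.add_apply, Matrix.smul_apply, smul_eq_mul]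
  exact (analyticOnNhd_const.add ((Real.analyticOnNhd_cos.sub analyticOnNhd_const).mul
    analyticOnNhd_const)).add (Real.analyticOnNhd_sin.mul analyticOnNhd_const)

theorem continuous_planeRot (p : {p : Fin d × Fin d // p.1 ≠ p.2}) : Continuous (planeRot p) := by
  refine Continuous.subtype_mk (continuous_matrix fun a b => ?_) _
  exact continuousOn_univ.1 (analyticOnNhd_planeRotMatrix p.1.1 p.1.2 a b).continuousOn

theorem planeRotMatrix_mulVec_apply (i j : Fin d) (t : ℝ) (v : Fin d → ℝ) (k : Fin d) :
    (planeRotMatrix i j t *ᵥ v) k = v k + (Real.cos t - 1) * ((if k = i then v i else 0) +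
      (if k = j then v j else 0)) +
      Real.sin t * ((if k = i then v j else 0) - (if k = j then v i else 0)) := by
  simp [planeRotMatrix, add_mulVec, smul_mulVec, sub_mulVec, single_mulVec, Function.update_apply]
  split_ifs <;> ring

variable (d) in
/-- The subgroup of `SO(d)` generated by the coordinate plane rotations. -/
def planeRotSubgroup : Subgroup (SO d) := Subgroup.closure {g | ∃ p t, planeRot p t = g}

theorem planeRot_mem_subgroup (p : {p : Fin d × Fin d // p.1 ≠ p.2}) (t : ℝ) :
    planeRot p t ∈ planeRotSubgroup d := Subgroup.subset_closure ⟨p, t, rfl⟩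

theorem SO_dotProduct_mulVec (γ : SO d) (v w : Fin d → ℝ) :
    (γ.1 *ᵥ v) ⬝ᵥ (γ.1 *ᵥ w) = v ⬝ᵥ w := by
  have hγ : γ.1ᵀ * γ.1 = 1 :=
    (mem_orthogonalGroup_iff' _ _).1 (mem_specialOrthogonalGroup_iff.1 γ.2).1
  rw [dotProduct_mulVec, vecMul_mulVec, hγ, vecMul_one]

/-- Plane rotations inside the coordinate subspace `T` eliminate the coordinates in `U`. -/
theorem exists_planeRot_eliminate (T : Finset (Fin d)) {k : Fin d} (hk : k ∈ T) (v : Fin d → ℝ)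
    (hv : ∀ i ∉ T, v i = 0) (U : Finset (Fin d)) (hU : U ⊆ T.erase k) :
    ∃ h ∈ planeRotSubgroup d, (∀ i ∉ T, h.1 *ᵥ Pi.single i 1 = Pi.single i 1) ∧
      (∀ i ∉ T, (h.1 *ᵥ v) i = 0) ∧ (∀ i ∈ U, (h.1 *ᵥ v) i = 0) ∧
      (U.Nonempty → 0 ≤ (h.1 *ᵥ v) k) := by
  induction U using Finset.induction with
  | empty => exact ⟨1, one_mem _, fun _ _ => one_mulVec _, by simpa using hv, by simp, by simp⟩
  | insert i U hi ih =>
    obtain ⟨h, hH, h1, h2, h3, -⟩ := ih ((Finset.subset_insert _ _).trans hU)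
    have hiT := Finset.mem_erase.1 (hU (Finset.mem_insert_self i U))
    set w := h.1 *ᵥ v with hw
    -- Polar coordinates of the pair `(w k, w i)`: rotating by the argument moves the whole norm to
    -- coordinate `k`.
    let z : ℂ := ⟨w k, w i⟩
    have hc : ‖z‖ * Real.cos z.arg = w k := Complex.norm_mul_cos_arg z
    have hs : ‖z‖ * Real.sin z.arg = w i := Complex.norm_mul_sin_arg z
    have hcs := Real.sin_sq_add_cos_sq z.arg
    let R := planeRot ⟨(k, i), hiT.1.symm⟩ z.arg
    have hR : ∀ u, (R * h).1 *ᵥ u = planeRotMatrix k i z.arg *ᵥ (h.1 *ᵥ u) := fun u => by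
      rw [mulVec_mulVec]; rfl
    have hRk : ((R * h).1 *ᵥ v) k = ‖z‖ := by
      rw [hR, ← hw, planeRotMatrix_mulVec_apply]
      simp only [if_true, hiT.1.symm, if_false]
      linear_combination (-Real.cos z.arg) * hc - Real.sin z.arg * hs + ‖z‖ * hcs
    have hRi : ((R * h).1 *ᵥ v) i = 0 := by
      rw [hR, ← hw, planeRotMatrix_mulVec_apply]
      simp only [if_true, hiT.1, if_false]
      linear_combination (Real.sin z.arg) * hc - Real.cos z.arg * hs
    refine ⟨R * h, mul_mem (planeRot_mem_subgroup _ _) hH, fun j hj => ?_, fun j hj => ?_,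
      fun j hj => ?_, fun _ => hRk ▸ norm_nonneg z⟩
    · rw [hR, h1 j hj]
      have hjk : k ≠ j := by rintro rfl; exact hj hk
      have hji : i ≠ j := by rintro rfl; exact hj hiT.2
      ext l
      simp [planeRotMatrix_mulVec_apply, hjk, hji]
    · have hjk : j ≠ k := by rintro rfl; exact hj hk
      have hji : j ≠ i := by rintro rfl; exact hj hiT.2
      rw [hR, ← hw, planeRotMatrix_mulVec_apply]
      simp [hjk, hji, h2 j hj]
    · rcases eq_or_ne j i with rfl | hji
      · exact hRi
      · have hjU := (Finset.mem_insert.1 hj).resolve_left hji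
        have hjk : j ≠ k := (Finset.mem_erase.1 (hU hj)).1
        rw [hR, ← hw, planeRotMatrix_mulVec_apply]
        simp [hjk, hji, h3 j hjU]

/-- Induction on the number of coordinates not known to be fixed: plane rotations within `T` bring
`A e_k` back to `e_k`, and the product then fixes one more basis vector. -/
theorem mem_planeRotSubgroup_of_fix (n : ℕ) : ∀ (T : Finset (Fin d)) (A : SO d), T.card = n →
    (∀ i ∉ T, A.1 *ᵥ Pi.single i 1 = Pi.single i 1) → A ∈ planeRotSubgroup d := by
  induction n with
  | zero =>
    intro T A hT hA
    rw [Finset.card_eq_zero] at hT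
    subst hT
    have : A = 1 := by
      refine Subtype.ext (Matrix.ext fun a b => ?_)
      have := congrFun (hA b (by simp)) a
      rw [mulVec_single_one] at this
      simpa [Pi.single_apply, Matrix.one_apply] using this
    exact this ▸ one_mem _
  | succ n ih =>
    intro T A hT hA
    obtain ⟨k, hk⟩ : T.Nonempty := Finset.card_pos.1 (by omega)
    set v := A.1 *ᵥ Pi.single k 1 with hvdef
    have hv : ∀ i ∉ T, v i = 0 := by
      intro i hi
      have h := SO_dotProduct_mulVec A (Pi.single k 1) (Pi.single i 1)
      rw [hA i hi, ← hvdef] at h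
      have hik : k ≠ i := by rintro rfl; exact hi hk
      simpa [hik] using h
    have hvv : v ⬝ᵥ v = 1 := by
      rw [hvdef, SO_dotProduct_mulVec]; simp
    by_cases hU : (T.erase k).Nonempty
    · obtain ⟨h, hH, h1, h2, h3, h4⟩ := exists_planeRot_eliminate T hk v hv _ subset_rfl
      have hw0 : ∀ i, i ≠ k → (h.1 *ᵥ v) i = 0 := fun i hi => by
        by_cases hiT : i ∈ T
        · exact h3 i (Finset.mem_erase.2 ⟨hi, hiT⟩)
        · exact h2 i hiT
      have hw1 : (h.1 *ᵥ v) k = 1 := by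
        have h5 := SO_dotProduct_mulVec h v v
        rw [hvv, dotProduct, Finset.sum_eq_single k (fun i _ hi => by rw [hw0 i hi, zero_mul])
          (by simp)] at h5
        nlinarith [h4 hU]
      have hw : h.1 *ᵥ v = Pi.single k 1 := by
        ext i
        rcases eq_or_ne i k with rfl | hi
        · simpa using hw1
        · simpa [hi] using hw0 i hi
      have hmem : h * A ∈ planeRotSubgroup d := by
        refine ih (T.erase k) (h * A) (by rw [Finset.card_erase_of_mem hk, hT]; rfl) fun i hi => ?_
        have hmul : (h * A).1 *ᵥ Pi.single i 1 = h.1 *ᵥ (A.1 *ᵥ Pi.single i 1) := by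
          rw [mulVec_mulVec]; rfl
        rw [hmul]
        rcases eq_or_ne i k with rfl | hik
        · exact hw
        · have hiT : i ∉ T := fun h => hi (Finset.mem_erase.2 ⟨hik, h⟩)
          rw [hA i hiT, h1 i hiT]
      exact (Subgroup.mul_mem_cancel_left _ hH).1 hmem
    -- Here `T = {k}`: no plane is available to correct a sign, but `A` is diagonal with one free
    -- entry, which the determinant forces to be `1`.
    · have hTk : ∀ i, i ≠ k → i ∉ T := fun i hi hiT => hU ⟨i, Finset.mem_erase.2 ⟨hi, hiT⟩⟩
      have hAe : ∀ a b, A.1 a b = if b = k then v a else if a = b then 1 else 0 := by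
        intro a b
        by_cases hb : b = k
        · subst hb
          simp [hvdef]
        · have := congrFun (hA b (hTk b hb)) a
          rw [mulVec_single_one] at this
          simpa [hb, Pi.single_apply] using this
      have hdiag : A.1 = diagonal (fun i => if i = k then v k else 1) := by
        ext a b
        rw [hAe, diagonal_apply]
        rcases eq_or_ne a b with rfl | hab
        · by_cases ha : a = k
          · simp [ha]
          · simp [ha]
        · by_cases hb : b = k
          · subst hb
            simp [hab, hv a (hTk a hab)]
          · simp [hab, hb]
      have hdet : A.1.det = 1 := (mem_specialOrthogonalGroup_iff.1 A.2).2
      have hvk : v k = 1 := by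
        rw [hdiag, det_diagonal] at hdet
        simpa using hdet
      have : A = 1 := Subtype.ext (by rw [hdiag, hvk]; simp)
      exact this ▸ one_mem _

theorem planeRotSubgroup_eq_top : planeRotSubgroup d = ⊤ :=
  (Subgroup.eq_top_iff' _).2 fun A => mem_planeRotSubgroup_of_fix _ Finset.univ A rfl (by simp)

/-- Plane rotations in one factor of `SO(d)^ℓ`. -/
noncomputable def piPlaneRot {ℓ : ℕ} (q : Fin ℓ × {p : Fin d × Fin d // p.1 ≠ p.2}) (t : ℝ) :
    Fin ℓ → SO d :=
  Pi.mulSingle q.1 (planeRot q.2 t)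

theorem closure_piPlaneRot (ℓ : ℕ) :
    Subgroup.closure {g : Fin ℓ → SO d | ∃ q t, piPlaneRot q t = g} = ⊤ := by
  rw [eq_top_iff, ← Subgroup.pi_top Set.univ, Subgroup.pi_le_iff]
  intro i
  rw [← planeRotSubgroup_eq_top, planeRotSubgroup, MonoidHom.map_closure, Subgroup.closure_le]
  rintro _ ⟨_, ⟨p, t, rfl⟩, rfl⟩
  exact Subgroup.subset_closure ⟨(i, p), t, rfl⟩

end planeRot

/-! ### Analyticity along plane rotations and the size of zero sets -/

theorem analyticOnNhd_det {n : Type*} [Fintype n] [DecidableEq n] {M : ℝ → Matrix n n ℝ}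
    (hM : ∀ a b, AnalyticOnNhd ℝ (fun t => M t a b) Set.univ) :
    AnalyticOnNhd ℝ (fun t => (M t).det) Set.univ := by
  simp only [Matrix.det_apply']
  exact Finset.analyticOnNhd_fun_sum _ fun σ _ =>
    analyticOnNhd_const.mul (Finset.analyticOnNhd_fun_prod _ fun i _ => hM _ _)

theorem analyticOnNhd_matrix_mul {l m n : Type*} [Fintype m] {M : ℝ → Matrix l m ℝ}
    {N : ℝ → Matrix m n ℝ} (hM : ∀ a b, AnalyticOnNhd ℝ (fun t => M t a b) Set.univ)
    (hN : ∀ a b, AnalyticOnNhd ℝ (fun t => N t a b) Set.univ) (a : l) (b : n) :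
    AnalyticOnNhd ℝ (fun t => (M t * N t) a b) Set.univ := by
  simp only [Matrix.mul_apply]
  exact Finset.analyticOnNhd_fun_sum _ fun i _ => (hM _ _).mul (hN _ _)

theorem analyticOnNhd_translate_piPlaneRot {d ℓ : ℕ}
    (q : Fin ℓ × {p : Fin d × Fin d // p.1 ≠ p.2}) (g h : Fin ℓ → SO d) (k : Fin ℓ)
    (a b : Fin d) :
    AnalyticOnNhd ℝ (fun t => ((h * piPlaneRot q t * g) k).1 a b) Set.univ := by
  change AnalyticOnNhd ℝ (fun t => ((h k).1 * (piPlaneRot q t k).1 * (g k).1) a b) Set.univ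
  refine analyticOnNhd_matrix_mul (M := fun t => (h k).1 * (piPlaneRot q t k).1)
    (N := fun _ => (g k).1) (analyticOnNhd_matrix_mul (M := fun _ => (h k).1)
    (fun _ _ => analyticOnNhd_const) fun a b => ?_) (fun _ _ => analyticOnNhd_const) a b
  by_cases hk : k = q.1
  · subst hk
    simpa [piPlaneRot] using! analyticOnNhd_planeRotMatrix q.2.1.1 q.2.1.2 a b
  · simp [piPlaneRot, Pi.mulSingle_eq_of_ne hk, analyticOnNhd_const]

/-- A continuous function on `SO(d)^ℓ` which is not identically zero and is analytic along
translates of plane rotations has a closed nowhere dense null set of zeros. -/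
theorem zeroSet_nowhereDense_null {d ℓ : ℕ} {F : (Fin ℓ → SO d) → ℝ} (hF : Continuous F)
    (han : ∀ q g h, AnalyticOnNhd ℝ (fun t => F (h * piPlaneRot q t * g)) Set.univ)
    (hne : ∃ γ, F γ ≠ 0) :
    IsNowhereDense {γ | F γ = 0} ∧ IsHaarNull {γ | F γ = 0} := by
  have hcl : IsClosed {γ | F γ = 0} := isClosed_eq hF continuous_const
  have hnull : IsHaarNull {γ | F γ = 0} := by
    refine OneParam.IsThin.measure_eq_zero (φ := piPlaneRot) (fun q => ?_) (fun q => ?_)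
      (fun q t => ?_) (closure_piPlaneRot ℓ) ⟨hcl, fun q g h => ?_⟩ ?_ _
    · exact (continuous_mulSingle q.1).comp (continuous_planeRot q.2)
    · simp [piPlaneRot, planeRot_zero]
    · rw [piPlaneRot, ← Pi.mulSingle_inv, planeRot_inv]; rfl
    · exact analytic_zeroSet_univ_or_null (han q g h)
    · obtain ⟨γ, hγ⟩ := hne
      exact fun h => hγ (h ▸ Set.mem_univ γ : γ ∈ {γ | F γ = 0})
  refine ⟨?_, hnull⟩
  rw [hcl.isNowhereDense_iff]
  -- Haar measure charges every nonempty open set.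
  exact Measure.interior_eq_empty_of_null hnull

/-! ### Kronecker powers -/

section kroneckerPow

variable {d : ℕ} {R : Type*} [CommRing R]

/-- The `n`-fold Kronecker power of a matrix, indexed by words of length `n`. -/
def kroneckerPow (n : ℕ) (A : Matrix (Fin d) (Fin d) R) :
    Matrix (Fin n → Fin d) (Fin n → Fin d) R :=
  Matrix.of fun w w' => ∏ i, A (w i) (w' i)

theorem kroneckerPow_apply (n : ℕ) (A : Matrix (Fin d) (Fin d) R) (w w' : Fin n → Fin d) :
    kroneckerPow n A w w' = ∏ i, A (w i) (w' i) := rfl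

theorem kroneckerPow_mul (n : ℕ) (A B : Matrix (Fin d) (Fin d) R) :
    kroneckerPow n (A * B) = kroneckerPow n A * kroneckerPow n B := by
  ext w w'
  simp only [kroneckerPow_apply, Matrix.mul_apply, ← Finset.prod_mul_distrib]
  rw [Finset.prod_univ_sum, Fintype.piFinset_univ]

theorem kroneckerPow_diagonal (n : ℕ) (v : Fin d → R) :
    kroneckerPow n (Matrix.diagonal v) = Matrix.diagonal fun w => ∏ i, v (w i) := by
  ext w w'
  rw [kroneckerPow_apply, Matrix.diagonal_apply]
  split_ifs with h
  · subst h; simp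
  · obtain ⟨i, hi⟩ := Function.ne_iff.1 h
    exact Finset.prod_eq_zero (Finset.mem_univ i) (Matrix.diagonal_apply_ne _ hi)

theorem kroneckerPow_one (n : ℕ) : kroneckerPow n (1 : Matrix (Fin d) (Fin d) R) = 1 := by
  rw [← Matrix.diagonal_one, kroneckerPow_diagonal]
  simp

theorem kroneckerPow_transpose (n : ℕ) (A : Matrix (Fin d) (Fin d) R) :
    kroneckerPow n A.transpose = (kroneckerPow n A).transpose := rfl

end kroneckerPow

/-! ### Moments of functions on the sphere -/

section sphere

open Matrix

variable {d : ℕ}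

instance (d : ℕ) : IsFiniteMeasure (sphereMeasure d) := by
  unfold sphereMeasure; infer_instance

theorem act_mul (a b : SO d) (x : Sphere d) : act (a * b) x = act a (act b x) := by
  refine Subtype.ext ?_
  change WithLp.toLp 2 ((a.1 * b.1) *ᵥ x.1.ofLp) = WithLp.toLp 2 (a.1 *ᵥ (b.1 *ᵥ x.1.ofLp))
  rw [mulVec_mulVec]

theorem act_one (x : Sphere d) : act (1 : SO d) x = x := by
  refine Subtype.ext ?_
  change WithLp.toLp 2 ((1 : Matrix (Fin d) (Fin d) ℝ) *ᵥ x.1.ofLp) = x.1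
  rw [one_mulVec]

theorem continuous_act (γ : SO d) : Continuous (act γ) := by
  refine Continuous.subtype_mk ?_ _
  exact (PiLp.continuous_toLp 2 _).comp (continuous_const.matrix_mulVec
    ((PiLp.continuous_ofLp 2 _).comp continuous_subtype_val))

/-- The action of a rotation as a homeomorphism of the sphere. -/
def actHomeomorph (γ : SO d) : Sphere d ≃ₜ Sphere d where
  toFun := act γ
  invFun := act γ⁻¹
  left_inv x := by rw [← act_mul, inv_mul_cancel, act_one]
  right_inv x := by rw [← act_mul, mul_inv_cancel, act_one]
  continuous_toFun := continuous_act γ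
  continuous_invFun := continuous_act γ⁻¹

/-- A rotation as a linear isometry of Euclidean space. -/
noncomputable def rotIsometry (γ : SO d) :
    EuclideanSpace ℝ (Fin d) ≃ₗᵢ[ℝ] EuclideanSpace ℝ (Fin d) :=
  LinearIsometry.toLinearIsometryEquiv
    { toLinearMap := Matrix.toEuclideanLin γ.1
      norm_map' := fun x => by
        have key : ‖Matrix.toEuclideanLin γ.1 x‖ ^ 2 = ‖x‖ ^ 2 := by
          rw [EuclideanSpace.real_norm_sq_eq, EuclideanSpace.real_norm_sq_eq]
          simpa [dotProduct, sq, Matrix.toLpLin_apply] using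
            SO_dotProduct_mulVec γ x.ofLp x.ofLp
        exact (sq_eq_sq₀ (norm_nonneg _) (norm_nonneg _)).1 key } rfl

theorem rotIsometry_coe (γ : SO d) (x : Sphere d) : rotIsometry γ x.1 = (act γ x).1 := rfl

-- The surface measure of `s` is, up to a constant factor, the volume of the cone over `s`, and the
-- linear isometry extending `act γ` preserves volume and matches the cones.
open scoped Pointwise in
theorem measurePreserving_act (γ : SO d) :
    MeasurePreserving (act γ) (sphereMeasure d) (sphereMeasure d) := by
  refine ⟨(continuous_act γ).measurable, Measure.ext fun s hs => ?_⟩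
  rw [Measure.map_apply (continuous_act γ).measurable hs, sphereMeasure,
    Measure.toSphere_apply' _ hs,
    Measure.toSphere_apply' _ ((continuous_act γ).measurable hs)]
  congr 1
  have hset : (Set.Ioo (0 : ℝ) 1 • ((↑) '' (act γ ⁻¹' s)) : Set (EuclideanSpace ℝ (Fin d))) =
      rotIsometry γ ⁻¹' (Set.Ioo (0 : ℝ) 1 • ((↑) '' s)) := by
    ext x
    simp only [Set.mem_smul, Set.mem_image, Set.mem_preimage]
    constructor
    · rintro ⟨c, hc, _, ⟨y, hy, rfl⟩, rfl⟩
      exact ⟨c, hc, _, ⟨act γ y, hy, rfl⟩, by rw [map_smul, rotIsometry_coe]⟩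
    · rintro ⟨c, hc, _, ⟨y, hy, rfl⟩, hx⟩
      refine ⟨c, hc, _, ⟨act γ⁻¹ y, ?_, rfl⟩, (rotIsometry γ).injective ?_⟩
      · rwa [← act_mul, mul_inv_cancel, act_one]
      · rw [map_smul, rotIsometry_coe, ← act_mul, mul_inv_cancel, act_one, hx]
  rw [hset]
  exact (rotIsometry γ).measurePreserving.measure_preimage_emb
    (rotIsometry γ).toHomeomorph.measurableEmbedding _

theorem integral_actFun_mul (γ : SO d) (f φ : Sphere d → ℝ) :
    ∫ x, actFun γ f x * φ x ∂sphereMeasure d = ∫ x, f x * φ (act γ x) ∂sphereMeasure d := by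
  rw [← (measurePreserving_act γ).integral_comp (actHomeomorph γ).measurableEmbedding]
  refine integral_congr_ae (.of_forall fun x => ?_)
  simp only [actFun]
  rw [← act_mul, inv_mul_cancel, act_one]

/-- The monomial function on the sphere given by a word in the coordinates. -/
noncomputable def sphereMonomial {n : ℕ} (w : Fin n → Fin d) : C(Sphere d, ℝ) where
  toFun x := ∏ i, x.1.ofLp (w i)
  continuous_toFun := by fun_prop

theorem sphereMonomial_act {n : ℕ} (w : Fin n → Fin d) (γ : SO d) (x : Sphere d) :
    sphereMonomial w (act γ x) = ∑ w', kroneckerPow n γ.1 w w' * sphereMonomial w' x := by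
  change ∏ i, (γ.1 *ᵥ x.1.ofLp) (w i) =
    ∑ w' : Fin n → Fin d, (∏ i, γ.1 (w i) (w' i)) * ∏ i, x.1.ofLp (w' i)
  simp only [mulVec, dotProduct, ← Finset.prod_mul_distrib]
  rw [Finset.prod_univ_sum, Fintype.piFinset_univ]

/-- The moment of `g` against a monomial. -/
noncomputable def sphereMoment (g : Sphere d → ℝ) (n : ℕ) (w : Fin n → Fin d) : ℝ :=
  ∫ x, g x * sphereMonomial w x ∂sphereMeasure d

theorem integrable_mul_continuousMap {g : Sphere d → ℝ} (hg : MemLp g 2 (sphereMeasure d))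
    (φ : C(Sphere d, ℝ)) : Integrable (fun x => g x * φ x) (sphereMeasure d) :=
  hg.integrable_mul (q := 2)
    (φ.continuous.memLp_of_hasCompactSupport (HasCompactSupport.of_compactSpace _))

theorem sphereMoment_actFun {g : Sphere d → ℝ} (hg : MemLp g 2 (sphereMeasure d)) (γ : SO d)
    (n : ℕ) : sphereMoment (actFun γ g) n = kroneckerPow n γ.1 *ᵥ sphereMoment g n := by
  ext w
  rw [sphereMoment, integral_actFun_mul, mulVec, dotProduct]
  simp only [sphereMonomial_act, Finset.mul_sum]
  rw [integral_finsetSum]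
  · refine Finset.sum_congr rfl fun w' _ => ?_
    rw [sphereMoment, ← integral_const_mul]
    exact integral_congr_ae (.of_forall fun x => by ring)
  · intro w' _
    refine ((integrable_mul_continuousMap hg (sphereMonomial w')).const_mul
      (kroneckerPow n γ.1 w w')).congr (.of_forall fun x => by ring)

theorem memLp_actFun {g : Sphere d → ℝ} (hg : MemLp g 2 (sphereMeasure d)) (γ : SO d) :
    MemLp (actFun γ g) 2 (sphereMeasure d) :=
  hg.comp_measurePreserving (measurePreserving_act γ⁻¹)

theorem sum_kroneckerPow_mulVec_moment {r : ℕ} {g : Sphere d → ℝ}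
    (hg : MemLp g 2 (sphereMeasure d)) (γ : Fin r → SO d)
    (h0 : ∀ᵐ x ∂sphereMeasure d, ∑ i, actFun (γ i) g x = 0) (n : ℕ) :
    (∑ i, kroneckerPow n (γ i).1) *ᵥ sphereMoment g n = 0 := by
  rw [Matrix.sum_mulVec]
  simp only [← sphereMoment_actFun hg]
  ext w
  simp only [Finset.sum_apply, sphereMoment, Pi.zero_apply]
  rw [← integral_finsetSum _ fun i _ => integrable_mul_continuousMap (memLp_actFun hg (γ i)) _]
  refine integral_eq_zero_of_ae ?_
  filter_upwards [h0] with x hx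
  rw [← Finset.sum_mul, hx, zero_mul, Pi.zero_apply]

theorem exists_sphereMonomial_of_mem_closure {φ : C(Sphere d, ℝ)}
    (hφ : φ ∈ Submonoid.closure
      (Set.range fun j : Fin d => sphereMonomial (fun _ : Fin 1 => j))) :
    ∃ (n : ℕ) (w : Fin n → Fin d), φ = sphereMonomial w := by
  induction hφ using Submonoid.closure_induction with
  | mem x hx => obtain ⟨j, rfl⟩ := hx; exact ⟨1, _, rfl⟩
  | one => exact ⟨0, Fin.elim0, by ext x; simp [sphereMonomial]⟩
  | mul x y _ _ hx hy =>
    obtain ⟨m, v, rfl⟩ := hx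
    obtain ⟨n, w, rfl⟩ := hy
    refine ⟨m + n, Fin.append v w, ?_⟩
    ext x
    simp [sphereMonomial, Fin.prod_univ_add]

/-- An `L²` function on the sphere with vanishing moments is zero. -/
theorem ae_eq_zero_of_sphereMoment {g : Sphere d → ℝ} (hg : MemLp g 2 (sphereMeasure d))
    (h : ∀ n, sphereMoment g n = 0) : g =ᵐ[sphereMeasure d] 0 := by
  let μ := sphereMeasure d
  let Φ : C(Sphere d, ℝ) →L[ℝ] ℝ := (innerSL ℝ (hg.toLp g)).comp (ContinuousMap.toLp 2 μ ℝ)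
  have hΦ : ∀ φ, Φ φ = ∫ x, g x * φ x ∂μ := fun φ => by
    change inner ℝ (hg.toLp g) (ContinuousMap.toLp 2 μ ℝ φ) = _
    rw [L2.inner_def]
    refine integral_congr_ae ?_
    filter_upwards [hg.coeFn_toLp, ContinuousMap.coeFn_toLp (p := 2) μ (𝕜 := ℝ) φ] with x h1 h2
    rw [h1, h2]
    simp [mul_comm]
  -- Monomials span this algebra, so `Φ` kills it; Stone–Weierstrass extends this to all continuous
  -- functions, and their density in `L²` gives `g = 0`.
  let A := Algebra.adjoin ℝ (Set.range fun j : Fin d => sphereMonomial (fun _ : Fin 1 => j))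
  have hA : ∀ φ ∈ A, Φ φ = 0 := by
    have hle : Subalgebra.toSubmodule A ≤ LinearMap.ker Φ.toLinearMap := by
      rw [Algebra.adjoin_eq_span, Submodule.span_le]
      intro φ hφ
      obtain ⟨n, w, rfl⟩ := exists_sphereMonomial_of_mem_closure hφ
      change Φ _ = 0
      rw [hΦ]
      exact congrFun (h n) w
    exact fun φ hφ => hle hφ
  have hsep : A.SeparatesPoints := by
    intro x y hxy
    have : ∃ j, x.1.ofLp j ≠ y.1.ofLp j := by
      by_contra! hall
      exact hxy (Subtype.ext (PiLp.ext hall))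
    obtain ⟨j, hj⟩ := this
    refine ⟨_, ⟨_, Algebra.subset_adjoin ⟨j, rfl⟩, rfl⟩, ?_⟩
    simpa [sphereMonomial] using hj
  have htop := ContinuousMap.subalgebra_topologicalClosure_eq_top_of_separatesPoints A hsep
  have hΦ0 : ∀ φ, Φ φ = 0 := fun φ => by
    have hφ : φ ∈ closure (A : Set C(Sphere d, ℝ)) := by
      rw [← Subalgebra.topologicalClosure_coe, htop]; trivial
    exact closure_minimal (t := {φ | Φ φ = 0}) hA
      (isClosed_eq Φ.continuous continuous_const) hφ
  have hinner : ∀ u, inner ℝ (hg.toLp g) u = 0 := by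
    have := (ContinuousMap.toLp_denseRange ℝ μ ℝ (p := 2) (by simp)).equalizer
      (innerSL ℝ (hg.toLp g)).continuous (continuous_const (y := (0 : ℝ)))
      (funext fun φ => hΦ0 φ)
    exact fun u => congrFun this u
  have hz : hg.toLp g = 0 := inner_self_eq_zero.1 (hinner _)
  have h1 := hg.coeFn_toLp
  rw [hz] at h1
  exact h1.symm.trans (Lp.coeFn_zero _ _ _)

/-- A fractionally dividing tuple makes one of the operators `∑ i, γ_i^{⊗ n}` singular. -/
theorem exists_det_eq_zero_of_fractionallyDivides {r : ℕ} (hr : r ≠ 0) {γ : Fin r → SO d}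
    (h : FractionallyDivides γ) : ∃ n, (∑ i, kroneckerPow n (γ i).1).det = 0 := by
  obtain ⟨f, hf, hsum, hpos⟩ := h
  let g : Sphere d → ℝ := fun x => f x - 1 / r
  have hg : MemLp g 2 (sphereMeasure d) := hf.sub (memLp_const _)
  have h0 : ∀ᵐ x ∂sphereMeasure d, ∑ i, actFun (γ i) g x = 0 := by
    filter_upwards [hsum] with x hx
    simp only [actFun, g, Finset.sum_sub_distrib] at hx ⊢
    rw [hx]
    have : (r : ℝ) ≠ 0 := Nat.cast_ne_zero.2 hr
    simp [this]
  by_contra! hdet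
  have hz := ae_eq_zero_of_sphereMoment hg fun n =>
    Matrix.eq_zero_of_mulVec_eq_zero (hdet n) (sum_kroneckerPow_mulVec_moment hg γ h0 n)
  refine hpos.ne' (measure_mono_null (fun x hx => ?_) (mem_ae_iff.1 hz))
  exact fun h => hx (sub_eq_zero.1 h)

end sphere

/-! ### Choosing free rotations that make the operators invertible -/

section invertible

open Matrix

theorem norm_kroneckerPow_mulVec {d : ℕ} (n : ℕ) (γ : SO d) (v : (Fin n → Fin d) → ℝ) :
    ‖WithLp.toLp 2 (kroneckerPow n γ.1 *ᵥ v)‖ = ‖WithLp.toLp 2 v‖ := by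
  have hγ : γ.1ᵀ * γ.1 = 1 :=
    (mem_orthogonalGroup_iff' _ _).1 (mem_specialOrthogonalGroup_iff.1 γ.2).1
  have hk : (kroneckerPow n γ.1)ᵀ * kroneckerPow n γ.1 = 1 := by
    rw [← kroneckerPow_transpose, ← kroneckerPow_mul, hγ, kroneckerPow_one]
  have key : ‖WithLp.toLp 2 (kroneckerPow n γ.1 *ᵥ v)‖ ^ 2 = ‖WithLp.toLp 2 v‖ ^ 2 := by
    rw [EuclideanSpace.real_norm_sq_eq, EuclideanSpace.real_norm_sq_eq]
    have : (kroneckerPow n γ.1 *ᵥ v) ⬝ᵥ (kroneckerPow n γ.1 *ᵥ v) = v ⬝ᵥ v := by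
      rw [dotProduct_mulVec, vecMul_mulVec, hk, vecMul_one]
    simpa [dotProduct, sq] using this
  exact (sq_eq_sq₀ (norm_nonneg _) (norm_nonneg _)).1 key

/-- If at least half of the rotations may be chosen freely, they can be chosen such that the
operator `∑ i, γ_i^{⊗ n}` is invertible: make them equal to one of the given rotations. -/
theorem exists_det_sum_kroneckerPow_ne_zero {d ℓ k : ℕ} (hk : k ≤ ℓ) (γ' : Fin (k + 1) → SO d)
    (n : ℕ) : ∃ γ : Fin ℓ → SO d, (∑ i, kroneckerPow n (Fin.append γ γ' i).1).det ≠ 0 := by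
  refine ⟨fun _ => γ' 0, fun hdet => ?_⟩
  obtain ⟨v, hv, hv0⟩ := exists_mulVec_eq_zero_iff.2 hdet
  let a : Fin (k + 1) → EuclideanSpace ℝ (Fin n → Fin d) :=
    fun j => WithLp.toLp 2 (kroneckerPow n (γ' j).1 *ᵥ v)
  have ha : ∀ j, ‖a j‖ = ‖WithLp.toLp 2 v‖ := fun j => norm_kroneckerPow_mulVec n _ v
  have hpos : 0 < ‖WithLp.toLp 2 v‖ := by
    rw [norm_pos_iff]
    exact fun h => hv ((WithLp.toLp_eq_zero 2).1 h)
  -- A kernel vector would balance `ℓ + 1` copies of `a 0` against `k ≤ ℓ` vectors of the same norm.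
  have hsum : ((ℓ : ℝ) + 1) • a 0 = -∑ j : Fin k, a j.succ := by
    have h1 := congrArg (WithLp.toLp 2) hv0
    simp only [Fin.sum_univ_add, Fin.append_left, Fin.append_right, Fin.sum_univ_succ,
      Finset.sum_const, Finset.card_univ, Fintype.card_fin, add_mulVec, sum_mulVec, smul_mulVec,
      WithLp.toLp_add, WithLp.toLp_sum, WithLp.toLp_smul, WithLp.toLp_zero] at h1
    rw [eq_neg_iff_add_eq_zero, ← h1, add_smul, one_smul, Nat.cast_smul_eq_nsmul, add_assoc]
  have h2 := congrArg norm hsum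
  rw [norm_neg, norm_smul, ha, Real.norm_of_nonneg (by positivity)] at h2
  have h3 : ‖∑ j : Fin k, a j.succ‖ ≤ k * ‖WithLp.toLp 2 v‖ := by
    refine (norm_sum_le _ _).trans (le_of_eq ?_)
    simp [ha]
  have h4 : (k : ℝ) ≤ ℓ := Nat.cast_le.2 hk
  nlinarith

/-- The change of basis diagonalizing all plane rotations. -/
def rotEigenbasis : Matrix (Fin 2) (Fin 2) ℂ := !![1, Complex.I; 1, -Complex.I]

/-- The eigenvalues of the plane rotation by the angle `s`. -/
noncomputable def rotEigenvalue (s : ℝ) (j : Fin 2) : ℂ :=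
  Complex.exp ((s * (![-1, 1] : Fin 2 → ℝ) j : ℝ) * Complex.I)

theorem rotEigenbasis_mul (A : Matrix (Fin 2) (Fin 2) ℝ) (s : ℝ)
    (hA : A = !![Real.cos s, Real.sin s; -Real.sin s, Real.cos s]) :
    rotEigenbasis * A.map Complex.ofReal = diagonal (rotEigenvalue s) * rotEigenbasis := by
  subst hA
  ext i j
  fin_cases i <;> fin_cases j <;>
    apply Complex.ext <;>
    simp [rotEigenbasis, rotEigenvalue, Matrix.mul_apply, Fin.sum_univ_two,
      Complex.exp_re, Complex.exp_im,
      -Complex.ofReal_cos, -Complex.ofReal_sin]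

theorem SO_two_eq_rotation (γ : SO 2) :
    ∃ s : ℝ, γ.1 = !![Real.cos s, Real.sin s; -Real.sin s, Real.cos s] := by
  obtain ⟨horth, hdet⟩ := mem_specialOrthogonalGroup_iff.1 γ.2
  have h1 := (mem_orthogonalGroup_iff _ _).1 horth
  have h00 := congrFun (congrFun h1 0) 0
  have h01 := congrFun (congrFun h1 0) 1
  simp [Matrix.mul_apply] at h00 h01
  rw [det_fin_two] at hdet
  have ha : γ.1 1 1 = γ.1 0 0 := by
    linear_combination γ.1 0 1 * h01 + γ.1 0 0 * hdet - γ.1 1 1 * h00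
  have hb : γ.1 1 0 = -γ.1 0 1 := by
    linear_combination γ.1 0 0 * h01 - γ.1 0 1 * hdet - γ.1 1 0 * h00
  let z : ℂ := ⟨γ.1 0 0, γ.1 0 1⟩
  have hz : ‖z‖ = 1 := by
    have : ‖z‖ ^ 2 = 1 := by
      rw [Complex.sq_norm, Complex.normSq_mk, h00]
    nlinarith [norm_nonneg z]
  have hc : Real.cos z.arg = γ.1 0 0 := by
    have := Complex.norm_mul_cos_arg z
    rwa [hz, one_mul] at this
  have hs : Real.sin z.arg = γ.1 0 1 := by
    have := Complex.norm_mul_sin_arg z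
    rwa [hz, one_mul] at this
  refine ⟨z.arg, ?_⟩
  rw [hc, hs, ← ha]
  ext i j
  fin_cases i <;> fin_cases j <;> simp [ha, hb]

theorem planeRotMatrix_two (t : ℝ) : planeRotMatrix (0 : Fin 2) 1 t =
    !![Real.cos t, Real.sin t; -Real.sin t, Real.cos t] := by
  ext i j
  fin_cases i <;> fin_cases j <;> simp [planeRotMatrix]

/-- The weight of a word. -/
noncomputable def wordWeight {n : ℕ} (w : Fin n → Fin 2) : ℝ :=
  ∑ i, (![-1, 1] : Fin 2 → ℝ) (w i)

theorem prod_rotEigenvalue {n : ℕ} (w : Fin n → Fin 2) (s : ℝ) :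
    ∏ i, rotEigenvalue s (w i) = Complex.exp ((s * wordWeight w : ℝ) * Complex.I) := by
  simp only [rotEigenvalue, wordWeight]
  rw [← Complex.exp_sum, ← Finset.sum_mul, ← Complex.ofReal_sum, Finset.mul_sum]

/-- Over `ℂ` the operator `∑ i, γ_i^{⊗ n}` for plane rotations is diagonalizable with explicit
eigenvalues. -/
theorem det_sum_kroneckerPow_two {r : ℕ} (n : ℕ) (γ : Fin r → SO 2) (s : Fin r → ℝ)
    (hs : ∀ i, (γ i).1 = !![Real.cos (s i), Real.sin (s i); -Real.sin (s i), Real.cos (s i)])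
    (h : ∀ w : Fin n → Fin 2, ∑ i, Complex.exp ((s i * wordWeight w : ℝ) * Complex.I) ≠ 0) :
    (∑ i, kroneckerPow n (γ i).1).det ≠ 0 := by
  intro hdet
  -- Kronecker powers are multiplicative, so they preserve invertibility.
  have hC : (kroneckerPow n rotEigenbasis).det ≠ 0 := by
    have h1 : rotEigenbasis * rotEigenbasis⁻¹ = 1 := by
      refine mul_nonsing_inv _ (Ne.isUnit ?_)
      rw [rotEigenbasis, det_fin_two_of]
      intro h
      have := congrArg Complex.im h
      norm_num at this
    have h2 := congrArg (fun M => (kroneckerPow n M).det) h1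
    simp only [kroneckerPow_mul, kroneckerPow_one, det_mul, det_one] at h2
    exact left_ne_zero_of_mul_eq_one h2
  have hconj : kroneckerPow n rotEigenbasis *
      (∑ i, kroneckerPow n (γ i).1).map Complex.ofReal =
      diagonal (fun w => ∑ i, Complex.exp ((s i * wordWeight w : ℝ) * Complex.I)) *
        kroneckerPow n rotEigenbasis := by
    have hmap : (∑ i, kroneckerPow n (γ i).1).map Complex.ofReal =
        ∑ i, kroneckerPow n ((γ i).1.map Complex.ofReal) := by
      ext w w'
      simp [Matrix.sum_apply, kroneckerPow_apply]
    have hdiag : diagonal (fun w : Fin n → Fin 2 =>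
        ∑ i, Complex.exp ((s i * wordWeight w : ℝ) * Complex.I)) =
        ∑ i, kroneckerPow n (diagonal (rotEigenvalue (s i))) := by
      simp only [kroneckerPow_diagonal, prod_rotEigenvalue]
      ext w w'
      rw [Matrix.sum_apply, diagonal_apply]
      split_ifs with hw
      · subst hw; simp
      · simp [hw]
    rw [hmap, hdiag, Finset.mul_sum, Finset.sum_mul]
    refine Finset.sum_congr rfl fun i _ => ?_
    rw [← kroneckerPow_mul, ← kroneckerPow_mul, rotEigenbasis_mul _ _ (hs i)]
  have hd := congrArg det hconj
  have hz : ((∑ i, kroneckerPow n (γ i).1).map Complex.ofReal).det = 0 := by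
    rw [← Complex.ofReal_zero, ← hdet]
    exact (RingHom.map_det Complex.ofRealHom _).symm
  rw [det_mul, det_mul, hz, mul_zero, det_diagonal] at hd
  exact mul_ne_zero (Finset.prod_ne_zero_iff.2 fun w _ => h w) hC hd.symm

/-- In the plane one free rotation suffices to make `∑ i, γ_i^{⊗ n}` invertible. -/
theorem exists_det_sum_kroneckerPow_two_ne_zero {m : ℕ} (γ' : Fin m → SO 2) (n : ℕ) :
    ∃ γ : Fin 1 → SO 2, (∑ i, kroneckerPow n (Fin.append γ γ' i).1).det ≠ 0 := by
  choose s hs using fun j => SO_two_eq_rotation (γ' j)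
  let f : (Fin n → Fin 2) → ℝ → ℂ := fun w t => Complex.exp ((t * wordWeight w : ℝ) * Complex.I) +
    ∑ j, Complex.exp ((s j * wordWeight w : ℝ) * Complex.I)
  have hf : ∀ w, volume {t | f w t = 0} = 0 := by
    intro w
    have han : AnalyticOnNhd ℝ (f w) Set.univ := by
      intro t _
      have h1 : AnalyticAt ℝ (fun t : ℝ => ((t * wordWeight w : ℝ) : ℂ) * Complex.I) t :=
        ((Complex.ofRealCLM.analyticAt _).comp
          (analyticAt_id.mul analyticAt_const)).mul analyticAt_const
      exact ((analyticAt_cexp.restrictScalars (𝕜 := ℝ)).fun_comp h1).add analyticAt_const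
    refine (analytic_zeroSet_univ_or_null han).resolve_left fun hall => ?_
    -- For weight `0` the eigenvalue is the positive integer `1 + m`. Otherwise the angles `0` and
    -- `π / wordWeight w` give `1 + c` and `-1 + c` with the same `c`, which cannot both vanish.
    by_cases hw : wordWeight w = 0
    · have := hall 0
      simp only [f, hw, mul_zero, Complex.ofReal_zero, zero_mul, Complex.exp_zero] at this
      simp only [Finset.sum_const, Finset.card_univ, Fintype.card_fin, nsmul_eq_mul,
        mul_one] at this
      norm_cast at this
      omega
    · have h0 := hall 0
      have h1 := hall (Real.pi / wordWeight w)
      simp only [f, zero_mul, Complex.ofReal_zero, Complex.exp_zero, div_mul_cancel₀ _ hw,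
        Complex.exp_pi_mul_I] at h0 h1
      have h2 := congrArg Complex.re (h0.trans h1.symm)
      simp at h2
      norm_num at h2
  -- There are finitely many words, and finitely many null sets do not cover the line.
  obtain ⟨t, ht⟩ : ∃ t, ∀ w, f w t ≠ 0 := by
    by_contra! hall
    have hU : (⋃ w, {t | f w t = 0}) = Set.univ :=
      Set.eq_univ_of_forall fun t => Set.mem_iUnion.2 (hall t)
    have := measure_iUnion_null (μ := volume) hf
    rw [hU] at this
    simp at this
  refine ⟨fun _ => planeRot ⟨(0, 1), by decide⟩ t, det_sum_kroneckerPow_two n _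
    (Fin.append (fun _ : Fin 1 => t) s) (fun i => ?_) fun w => ?_⟩
  · induction i using Fin.addCases with
    | left i => simpa using! planeRotMatrix_two t
    | right j => simpa using hs j
  · simpa [Fin.sum_univ_add, f] using ht w

end invertible

/-! ### Assembling the theorem -/

section conclusion

theorem continuous_det_sum_kroneckerPow {d ℓ m : ℕ} (γ' : Fin m → SO d) (n : ℕ) :
    Continuous fun γ : Fin ℓ → SO d =>
      (∑ i, kroneckerPow n (Fin.append γ γ' i).1).det := by
  refine Continuous.matrix_det (continuous_finsetSum _ fun i _ => continuous_matrix fun w w' => ?_)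
  simp only [kroneckerPow_apply]
  refine continuous_finsetProd _ fun j _ => Continuous.matrix_elem (A := fun γ : Fin ℓ → SO d =>
    (Fin.append γ γ' i).1) ?_ _ _
  induction i using Fin.addCases with
  | left i =>
    simpa using! continuous_subtype_val.comp (continuous_apply (A := fun _ : Fin ℓ => SO d) i)
  | right i => simpa using continuous_const

theorem analyticOnNhd_det_sum_kroneckerPow {d ℓ m : ℕ} (γ' : Fin m → SO d) (n : ℕ)
    (q : Fin ℓ × {p : Fin d × Fin d // p.1 ≠ p.2}) (g h : Fin ℓ → SO d) :
    AnalyticOnNhd ℝ (fun t =>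
      (∑ i, kroneckerPow n (Fin.append (h * piPlaneRot q t * g) γ' i).1).det) Set.univ := by
  refine analyticOnNhd_det fun w w' => ?_
  simp only [Matrix.sum_apply, kroneckerPow_apply]
  refine Finset.analyticOnNhd_fun_sum _ fun i _ => Finset.analyticOnNhd_fun_prod _ fun j _ => ?_
  induction i using Fin.addCases with
  | left i =>
    simp only [Fin.append_left]
    exact analyticOnNhd_translate_piPlaneRot q g h i _ _
  | right i =>
    simp only [Fin.append_right]
    exact analyticOnNhd_const

/-- If each operator `∑ i, γ_i^{⊗ n}` can be made invertible, the dividing section is small. -/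
theorem dividingSection_meagre_null {d ℓ m : ℕ} (hr : ℓ + m ≠ 0) (γ' : Fin m → SO d)
    (hne : ∀ n, ∃ γ : Fin ℓ → SO d, (∑ i, kroneckerPow n (Fin.append γ γ' i).1).det ≠ 0) :
    IsMeagre (dividingSection ℓ γ') ∧ IsHaarNull (dividingSection ℓ γ') := by
  have hsub : dividingSection ℓ γ' ⊆
      ⋃ n, {γ | (∑ i, kroneckerPow n (Fin.append γ γ' i).1).det = 0} := fun γ hγ =>
    Set.mem_iUnion.2 (exists_det_eq_zero_of_fractionallyDivides hr hγ)
  have hsmall := fun n => zeroSet_nowhereDense_null (continuous_det_sum_kroneckerPow γ' n)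
    (analyticOnNhd_det_sum_kroneckerPow γ' n) (hne n)
  exact ⟨(isMeagre_iUnion fun n => (hsmall n).1.isMeagre).mono hsub,
    measure_mono_null hsub (measure_iUnion_null fun n => (hsmall n).2)⟩

end conclusion

theorem theorem1p2 (d r : ℕ) (hd : 2 ≤ d) (hr : 2 ≤ r) (ℓ : ℕ)
    (hℓ : ℓ = if d = 2 then 1 else r / 2) :
    (fTop d r ≤ (ℓ : ℕ∞) ∧ fHaar d r ≤ (ℓ : ℕ∞)) ∧
      ∀ γ' : Fin (r - ℓ) → SO d,
        IsMeagre (dividingSection ℓ γ') ∧ IsHaarNull (dividingSection ℓ γ') := by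
  have hle : ℓ ≤ r := by split_ifs at hℓ <;> omega
  have main : ∀ γ' : Fin (r - ℓ) → SO d,
      IsMeagre (dividingSection ℓ γ') ∧ IsHaarNull (dividingSection ℓ γ') := by
    intro γ'
    refine dividingSection_meagre_null (by omega) γ' fun n => ?_
    split_ifs at hℓ with h2
    · subst h2 hℓ
      exact exists_det_sum_kroneckerPow_two_ne_zero γ' n
    -- One prescribed rotation serves as the model for the free ones; the other `k = r - ⌊r/2⌋ - 1`
    -- number at most `⌊r/2⌋`, for either parity of `r`.
    · obtain ⟨k, hk⟩ : ∃ k, r - ℓ = k + 1 := ⟨r - ℓ - 1, by omega⟩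
      have hkℓ : k ≤ ℓ := by omega
      revert γ'
      rw [hk]
      exact fun γ' => exists_det_sum_kroneckerPow_ne_zero hkℓ γ' n
  exact ⟨⟨sInf_le ⟨ℓ, rfl, hle, fun γ' => (main γ').1⟩,
    sInf_le ⟨ℓ, rfl, hle, fun γ' => (main γ').2⟩⟩, main⟩
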